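/- Consider the static, spherically symmetric, purely magnetic $\mathfrak{su}(2)$ Einstein--Yang--Mills equations with cosmological constant $\Lambda<0$ (units $G=c=g=1$) for real functions $m,S,\omega$ of $r$, where $N(r)=1-\frac{2m(r)}{r}-\frac{\Lambda r^2}{3}$ and the metric is $ds^2=-NS^2dt^2+N^{-1}dr^2+r^2(d\theta^2+\sin^2\theta\,d\phi^2)$: $$m'=N\omega'^2+\frac{(\omega^2-1)^2}{2r^2},\qquad \frac{S'}{S}=\frac{2\omega'^2}{r},$$ $$0=r^2N\omega''+\Bigl(2m-\frac{2\Lambda r^3}{3}-\frac{(\omega^2-1)^2}{r}\Bigr)\omega'+(1-\omega^2)\omega .$$ A regular, asymptotically AdS black hole solution with horizon radius $r_h>0$ and horizon value $\omega_h$ is a triple $(m,S,\omega)$ of functions that are $C^\infty$ on $[r_h,\infty)$ and satisfy these equations there, with $S>0$ on $[r_h,\infty)$, $N(r_h)=0$, $N'(r_h)>0$, $N(r)>0$ for all $r>r_h$, and $\omega(r_h)=\omega_h$, such that for some real constants $M,\omega_\infty,a$, as $r\to\infty$, $$m(r)=M+\frac1r\Bigl(\frac{\Lambda a^2}{3}-\frac12(\omega_\infty^2-1)^2\Bigr)+O(r^{-2}),\quad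 \omega(r)=\omega_\infty+\frac ar+\frac{3\omega_\infty(1-\omega_\infty^2)}{2\Lambda r^2}+O(r^{-3}),\quad S(r)=1+O(r^{-1}).$$ **Proposition.** Let $r_h>0$ and $\omega_h\neq0$ be fixed. Then there is $L>0$, depending only on $r_h$ and $\omega_h$, such that for every $\Lambda<0$ with $|\Lambda|>L$ there exists a regular, asymptotically AdS black hole solution with horizon radius $r_h$ and horizon value $\omega_h$ for which $\omega$ has no nodes, i.e. $\omega(r)\neq0$ for all $r\ge r_h$. -/

import Mathlib

open Set Filter Asymptotics

namespace EYM

/-- The metric function `N(r) = 1 - 2 m(r) / r - Λ r² / 3` of the static, spherically symmetric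
metric `ds² = -N S² dt² + N⁻¹ dr² + r² (dθ² + sin² θ dφ²)`. -/
noncomputable def metricN (Λ : ℝ) (m : ℝ → ℝ) (r : ℝ) : ℝ :=
  1 - 2 * m r / r - Λ * r ^ 2 / 3

/-- The derivative `f'` on the exterior region `[rh, ∞)`, one-sided at the horizon `rh`. -/
noncomputable def radialDeriv (rh : ℝ) (f : ℝ → ℝ) : ℝ → ℝ :=
  derivWithin f (Ici rh)

/-- The static, spherically symmetric, purely magnetic `su(2)` Einstein-Yang-Mills equations with
cosmological constant `Λ`, on `[rh, ∞)` (units `G = c = g = 1`). -/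
structure FieldEquations (Λ rh : ℝ) (m S ω : ℝ → ℝ) : Prop where
  mass : ∀ r, rh ≤ r →
    radialDeriv rh m r =
      metricN Λ m r * radialDeriv rh ω r ^ 2 + (ω r ^ 2 - 1) ^ 2 / (2 * r ^ 2)
  lapse : ∀ r, rh ≤ r →
    radialDeriv rh S r / S r = 2 * radialDeriv rh ω r ^ 2 / r
  yangMills : ∀ r, rh ≤ r →
    0 = r ^ 2 * metricN Λ m r * radialDeriv rh (radialDeriv rh ω) r
      + (2 * m r - 2 * Λ * r ^ 3 / 3 - (ω r ^ 2 - 1) ^ 2 / r) * radialDeriv rh ω r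
      + (1 - ω r ^ 2) * ω r

/-- The asymptotic form, as `r → ∞`, of the field variables of an asymptotically anti-de Sitter
solution, with free parameters `M`, `ωinf`, `a`. -/
def AsymptoticallyAdS (Λ : ℝ) (m S ω : ℝ → ℝ) : Prop :=
  ∃ M ωinf a : ℝ,
    (fun r => m r - (M + (Λ * a ^ 2 / 3 - (ωinf ^ 2 - 1) ^ 2 / 2) / r))
      =O[atTop] (fun r => 1 / r ^ 2) ∧
    (fun r => ω r - (ωinf + a / r + (3 * ωinf * (1 - ωinf ^ 2) / (2 * Λ)) / r ^ 2))
      =O[atTop] (fun r => 1 / r ^ 3) ∧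
    (fun r => S r - 1) =O[atTop] (fun r => 1 / r)

/-- `(m, S, ω)` is a regular, asymptotically anti-de Sitter black hole solution on `[rh, ∞)`, with
event horizon at `rh` and `ω(rh) = ωh`. -/
structure IsRegularBlackHole (Λ rh ωh : ℝ) (m S ω : ℝ → ℝ) : Prop where
  smooth_m : ContDiffOn ℝ ((⊤ : ℕ∞) : WithTop ℕ∞) m (Ici rh)
  smooth_S : ContDiffOn ℝ ((⊤ : ℕ∞) : WithTop ℕ∞) S (Ici rh)
  smooth_ω : ContDiffOn ℝ ((⊤ : ℕ∞) : WithTop ℕ∞) ω (Ici rh)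
  S_pos : ∀ r, rh ≤ r → 0 < S r
  equations : FieldEquations Λ rh m S ω
  horizon : metricN Λ m rh = 0
  /-- The horizon is regular (non-degenerate). -/
  horizon_regular : 0 < radialDeriv rh (metricN Λ m) rh
  /-- There is no further horizon outside `rh`. -/
  exterior : ∀ r, rh < r → 0 < metricN Λ m r
  horizon_value : ω rh = ωh
  asymptotic : AsymptoticallyAdS Λ m S ω

end EYM

/-! The limit `Λ → -∞` becomes a regular perturbation after compactifying. With `t = 1 - rh / r`, `M
= m / (|Λ| rh³)` and `p = N / (|Λ| r²)`, the equations for `ω` and `M` form a system on `[0, 1]` in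
which `Λ` enters only through `ε = 1 / (|Λ| rh²)`. At `ε = 0` it has the explicit solution `ω = ωh`,
`M = 1/6`, `p = (1 - (1 - t)³) / 3`. A solution for small `ε` that stays close to this one has a
nowhere vanishing `ω` and `p > 0` away from the horizon.

The equation for `v = dω/dt` is singular at `t = 0`, where `p` has a simple zero. In divergence form
it reads `(p v)' = F`; writing `p = t P` and dividing the integral of `F` by `t` leaves `P v = avg
F`, an equation between continuous functions with `P > 0` near the limit. With `ε = κ²` every
nonlinear term is of second order at the origin, so the residual map has derivative the identity
there (`hasStrictFDerivAt_residualMap`) and is locally onto; this gives a solution for each small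
`κ` (`exists_continuousMap_solution`).

The solution so obtained has only a continuous `v`. Smoothness up to the horizon comes from a
regularity theorem for `p y' = f - a y` with `a 0 > 0` (`contDiffOn_of_singular_linear`) and a
bootstrap. Since infinity is the regular endpoint `t = 1`, the required asymptotics are Taylor
expansions there. -/

namespace EYM

open Topology

/-! ### Regularity for linear equations at a regular singular point. -/

/-- A continuous function that starts non-positive and decreases wherever it is positive stays
non-positive. -/
theorem nonpos_of_deriv_neg_of_pos {d : ℝ → ℝ} {η : ℝ} (hc : ContinuousOn d (Ico 0 η))
    (h0 : d 0 ≤ 0) (hd : ∀ s ∈ Ioo 0 η, 0 < d s → ∃ d' < 0, HasDerivAt d d' s) :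
    ∀ s ∈ Ico 0 η, d s ≤ 0 := by
  intro s₁ hs₁
  by_contra! hpos
  obtain ⟨s, hs, hmax⟩ := isCompact_Icc.exists_isMaxOn (nonempty_Icc.2 hs₁.1)
    (hc.mono fun x (hx : x ∈ Icc 0 s₁) => ⟨hx.1, hx.2.trans_lt hs₁.2⟩)
  have hds : 0 < d s := hpos.trans_le (hmax (right_mem_Icc.2 hs₁.1))
  have hs0 : 0 < s := lt_of_le_of_ne hs.1 (by rintro rfl; linarith)
  obtain ⟨d', hd', hder⟩ := hd s ⟨hs0, hs.2.trans_lt hs₁.2⟩ hds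
  -- Only slopes from the left are used, as the maximum over `[0, s₁]` may sit at `s₁`.
  have hslope : ∀ᶠ x in 𝓝[<] s, slope d s x < 0 :=
    ((hasDerivAt_iff_tendsto_slope.1 hder).mono_left
      (nhdsWithin_mono _ fun x (hx : x < s) => hx.ne)).eventually_lt_const hd'
  obtain ⟨x, hx, hx0, hxs⟩ := (hslope.and (Ioo_mem_nhdsLT hs0)).exists
  have hle : d x ≤ d s := hmax ⟨hx0.le, hxs.le.trans hs.2⟩
  rw [slope_def_field] at hx
  exact absurd hx (not_lt.2 (div_nonneg_of_nonpos (by linarith) (by linarith)))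

/-- Solutions of `q' + (a / p) q = h` with `q 0 = 0` are eventually bounded by `(c + δ) p`, where
`c (p'(0) + a(0)) = h(0)`. -/
theorem eventually_le_of_singular_linear {p p' a h q : ℝ → ℝ} {c δ : ℝ} (hδ : 0 < δ)
    (hp0 : p 0 = 0) (hppos : ∀ s ∈ Ioc (0 : ℝ) 1, 0 < p s)
    (hp : ∀ s ∈ Ioo (0 : ℝ) 1, HasDerivAt p (p' s) s)
    (hpc : ContinuousOn p (Icc 0 1))
    (hp'c : ContinuousOn p' (Icc 0 1)) (hac : ContinuousOn a (Icc 0 1))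
    (hhc : ContinuousOn h (Icc 0 1)) (ha0 : 0 < a 0) (hp'0 : 0 < p' 0)
    (hc : c * (p' 0 + a 0) = h 0) (hqc : ContinuousOn q (Icc 0 1)) (hq0 : q 0 = 0)
    (hq : ∀ s ∈ Ioo (0 : ℝ) 1, HasDerivAt q (h s - a s * q s / p s) s) :
    ∀ᶠ s in 𝓝[>] (0 : ℝ), q s ≤ (c + δ) * p s := by
  have h0mem : (0 : ℝ) ∈ Icc (0 : ℝ) 1 := by simp
  have hE : ContinuousOn (fun s => h s - (c + δ) * (a s + p' s)) (Icc 0 1) := by fun_prop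
  have e1 : ∀ᶠ s in 𝓝[Icc 0 1] (0 : ℝ), h s - (c + δ) * (a s + p' s) < 0 := by
    -- By the choice of `c`, the value at `0` is `-δ (a 0 + p' 0)`.
    refine (hE 0 h0mem).eventually_lt_const ?_
    simp only
    nlinarith
  have e2 : ∀ᶠ s in 𝓝[Icc 0 1] (0 : ℝ), 0 < a s := (hac 0 h0mem).eventually_const_lt ha0
  have hnhds : 𝓝[Icc 0 1] (0 : ℝ) = 𝓝[≥] 0 := nhdsWithin_Icc_eq_nhdsGE one_pos
  rw [hnhds] at e1 e2
  obtain ⟨η, hη0, hη⟩ := mem_nhdsGE_iff_exists_Ico_subset.1 (e1.and e2)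
  have hη0 : (0 : ℝ) < η := hη0
  set η' := min η 1
  have hη' : 0 < η' := lt_min hη0 one_pos
  have key := nonpos_of_deriv_neg_of_pos (d := fun s => q s - (c + δ) * p s) (η := η')
    ((hqc.sub (hpc.const_mul (c + δ))).mono fun x (hx : x ∈ Ico 0 η') =>
      ⟨hx.1, (hx.2.trans_le (min_le_right _ _)).le⟩)
    (by simp [hq0, hp0]) (by
      intro s hs hpos
      have hs1 : s ∈ Ioo (0 : ℝ) 1 := ⟨hs.1, hs.2.trans_le (min_le_right _ _)⟩
      refine ⟨_, ?_, (hq s hs1).sub ((hp s hs1).const_mul (c + δ))⟩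
      obtain ⟨h1, h2⟩ := hη (show s ∈ Ico 0 η from ⟨hs.1.le, hs.2.trans_le (min_le_left _ _)⟩)
      have hps := hppos s ⟨hs1.1, hs1.2.le⟩
      have : a s * q s / p s = a s * (q s - (c + δ) * p s) / p s + (c + δ) * a s := by
        field_simp
        ring
      have h3 : 0 < a s * (q s - (c + δ) * p s) / p s := by positivity
      linarith)
  filter_upwards [Ioo_mem_nhdsGT hη'] with s hs
  have := key s ⟨hs.1.le, hs.2⟩
  linarith

/-- The one-sided bound applied to `q` and to `-q` squeezes `q / p`. -/
theorem tendsto_of_singular_linear {p p' a h q : ℝ → ℝ} {c : ℝ}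
    (hp0 : p 0 = 0) (hppos : ∀ s ∈ Ioc (0 : ℝ) 1, 0 < p s)
    (hp : ∀ s ∈ Ioo (0 : ℝ) 1, HasDerivAt p (p' s) s)
    (hpc : ContinuousOn p (Icc 0 1))
    (hp'c : ContinuousOn p' (Icc 0 1)) (hac : ContinuousOn a (Icc 0 1))
    (hhc : ContinuousOn h (Icc 0 1)) (ha0 : 0 < a 0) (hp'0 : 0 < p' 0)
    (hc : c * (p' 0 + a 0) = h 0) (hqc : ContinuousOn q (Icc 0 1)) (hq0 : q 0 = 0)
    (hq : ∀ s ∈ Ioo (0 : ℝ) 1, HasDerivAt q (h s - a s * q s / p s) s) :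
    Tendsto (fun s => q s / p s) (𝓝[>] 0) (𝓝 c) := by
  rw [Metric.tendsto_nhds]
  intro ε hε
  have hδ : 0 < ε / 2 := by positivity
  have up := eventually_le_of_singular_linear hδ hp0 hppos hp hpc hp'c hac hhc ha0 hp'0 hc hqc hq0 hq
  have lo := eventually_le_of_singular_linear (h := fun s => -h s) (q := fun s => -q s) (c := -c)
    hδ hp0 hppos hp hpc hp'c hac hhc.neg ha0 hp'0 (by linarith) hqc.neg (by simp [hq0])
    (fun s hs => (hq s hs).neg.congr_deriv (by ring))
  filter_upwards [up, lo, Ioo_mem_nhdsGT (one_pos : (0 : ℝ) < 1)] with s h1 h2 hs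
  have hps := hppos s ⟨hs.1, hs.2.le⟩
  have h3 : q s / p s ≤ c + ε / 2 := (div_le_iff₀ hps).2 h1
  have h4 : c - ε / 2 ≤ q s / p s := (le_div_iff₀ hps).2 (by linarith)
  rw [Real.dist_eq, abs_lt]
  constructor <;> linarith

/-- Regularity at a regular singular point: a continuous solution of `p y' = f - a y` on `(0, 1]`,
where `p` has a simple zero at `0` and `a 0 > 0`, is as smooth on `[0, 1]` as the coefficients. -/
theorem contDiffOn_of_singular_linear (k : ℕ) : ∀ {p a f y : ℝ → ℝ} {p₀ : ℝ},
    ContDiffOn ℝ k p (Icc 0 1) → ContDiffOn ℝ k a (Icc 0 1) → ContDiffOn ℝ k f (Icc 0 1) →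
    p 0 = 0 → HasDerivWithinAt p p₀ (Icc 0 1) 0 → 0 < p₀ → (∀ s ∈ Ioc (0 : ℝ) 1, 0 < p s) →
    0 < a 0 → a 0 * y 0 = f 0 → ContinuousOn y (Icc 0 1) →
    (∀ s ∈ Ioc (0 : ℝ) 1, HasDerivWithinAt y ((f s - a s * y s) / p s) (Icc 0 1) s) →
    ContDiffOn ℝ k y (Icc 0 1) := by
  induction k with
  | zero =>
    intro p a f y p₀ _ _ _ _ _ _ _ _ _ hy _
    exact contDiffOn_zero.2 hy
  | succ k ih =>
    intro p a f y p₀ hp ha hf hp0 hpd hp₀ hppos ha0 hcomp hy hyd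
    have hU : UniqueDiffOn ℝ (Icc (0 : ℝ) 1) := uniqueDiffOn_Icc one_pos
    have h0 : (0 : ℝ) ∈ Icc (0 : ℝ) 1 := by simp
    have hk : ((k : ℕ) : WithTop ℕ∞) ≤ ((k + 1 : ℕ) : WithTop ℕ∞) := by
      exact_mod_cast Nat.le_succ k
    have hyk : ContDiffOn ℝ k y (Icc 0 1) :=
      ih (hp.of_le hk) (ha.of_le hk) (hf.of_le hk) hp0 hpd hp₀ hppos ha0 hcomp hy hyd
    have split : ∀ {u : ℝ → ℝ}, ContDiffOn ℝ ((k + 1 : ℕ) : WithTop ℕ∞) u (Icc 0 1) →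
        DifferentiableOn ℝ u (Icc 0 1) ∧ ContDiffOn ℝ k (derivWithin u (Icc 0 1)) (Icc 0 1) := by
      intro u hu
      rw [Nat.cast_add, Nat.cast_one, contDiffOn_succ_iff_derivWithin hU] at hu
      exact ⟨hu.1, hu.2.2⟩
    obtain ⟨hpD, hp'⟩ := split hp
    obtain ⟨haD, ha'⟩ := split ha
    obtain ⟨hfD, hf'⟩ := split hf
    have hp'0 : derivWithin p (Icc 0 1) 0 = p₀ := hpd.derivWithin (hU 0 h0)
    set p' := derivWithin p (Icc 0 1) with hp'def
    set a' := derivWithin a (Icc 0 1) with ha'def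
    set f' := derivWithin f (Icc 0 1) with hf'def
    have hpI : ∀ s ∈ Icc (0 : ℝ) 1, HasDerivWithinAt p (p' s) (Icc 0 1) s :=
      fun s hs => (hpD s hs).hasDerivWithinAt
    have haI : ∀ s ∈ Icc (0 : ℝ) 1, HasDerivWithinAt a (a' s) (Icc 0 1) s :=
      fun s hs => (haD s hs).hasDerivWithinAt
    have hfI : ∀ s ∈ Icc (0 : ℝ) 1, HasDerivWithinAt f (f' s) (Icc 0 1) s :=
      fun s hs => (hfD s hs).hasDerivWithinAt
    have hsum : 0 < p' 0 + a 0 := by rw [hp'0]; linarith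
    -- Differentiating `p y' = f - a y` gives `p w' = h - (a + p') w` for `w = y'`: the same type of
    -- equation, with `a + p'` still positive at `0`. This drives the induction; `c` is the value of
    -- `w` at `0` that it forces.
    set h := fun s => f' s - a' s * y s with hhdef
    have hh : ContDiffOn ℝ k h (Icc 0 1) := hf'.sub (ha'.mul hyk)
    set c := h 0 / (p' 0 + a 0) with hcdef
    have hc : c * (p' 0 + a 0) = h 0 := div_mul_cancel₀ _ hsum.ne'
    have hqI : ∀ s ∈ Ioc (0 : ℝ) 1, HasDerivWithinAt (fun s => f s - a s * y s)
        (h s - a s * (f s - a s * y s) / p s) (Icc 0 1) s := by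
      intro s hs
      have hs' : s ∈ Icc (0 : ℝ) 1 := ⟨hs.1.le, hs.2⟩
      refine ((hfI s hs').sub ((haI s hs').mul (hyd s hs))).congr_deriv ?_
      simp only [hhdef]
      ring
    -- Away from `0`, `y' = q / p` with `q = f - a y`, which vanishes at `0` by compatibility. The
    -- limit makes `y` differentiable at `0` with continuous derivative.
    have hlim : Tendsto (fun s => (f s - a s * y s) / p s) (𝓝[>] 0) (𝓝 c) := by
      refine tendsto_of_singular_linear (p' := p') (a := a) (h := h) hp0 hppos ?_
        hp.continuousOn hp'.continuousOn ha.continuousOn hh.continuousOn ha0 (hp'0 ▸ hp₀) hc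
        (hf.continuousOn.sub (ha.continuousOn.mul hy)) (by simp [hcomp]) ?_
      · exact fun s hs => (hpI s ⟨hs.1.le, hs.2.le⟩).hasDerivAt (Icc_mem_nhds hs.1 hs.2)
      · exact fun s hs => (hqI s ⟨hs.1, hs.2.le⟩).hasDerivAt (Icc_mem_nhds hs.1 hs.2)
    have hy0 : HasDerivWithinAt y c (Icc 0 1) 0 := by
      have hder : ∀ s ∈ Ioo (0 : ℝ) 1, HasDerivAt y ((f s - a s * y s) / p s) s :=
        fun s hs => (hyd s ⟨hs.1, hs.2.le⟩).hasDerivAt (Icc_mem_nhds hs.1 hs.2)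
      refine (hasDerivWithinAt_Ici_of_tendsto_deriv (s := Ioo 0 1)
        (fun s hs => (hder s hs).differentiableAt.differentiableWithinAt)
        ((hy 0 h0).mono Ioo_subset_Icc_self) (Ioo_mem_nhdsGT one_pos) ?_).mono Icc_subset_Ici_self
      refine hlim.congr' ?_
      filter_upwards [Ioo_mem_nhdsGT (one_pos : (0 : ℝ) < 1)] with s hs
      exact (hder s hs).deriv.symm
    set w := derivWithin y (Icc 0 1) with hwdef
    have hw0 : w 0 = c := hy0.derivWithin (hU 0 h0)
    have hwI : ∀ s ∈ Ioc (0 : ℝ) 1, w s = (f s - a s * y s) / p s :=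
      fun s hs => (hyd s hs).derivWithin (hU s ⟨hs.1.le, hs.2⟩)
    have hyD : DifferentiableOn ℝ y (Icc 0 1) := by
      intro s hs
      rcases eq_or_lt_of_le hs.1 with rfl | hpos
      · exact hy0.differentiableWithinAt
      · exact (hyd s ⟨hpos, hs.2⟩).differentiableWithinAt
    have hIoc : ∀ s ∈ Ioc (0 : ℝ) 1, w =ᶠ[𝓝[Icc 0 1] s] fun s => (f s - a s * y s) / p s := by
      intro s hs
      filter_upwards [self_mem_nhdsWithin, mem_nhdsWithin_of_mem_nhds (Ioi_mem_nhds hs.1)]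
        with t ht ht0
      exact hwI t ⟨ht0, ht.2⟩
    have hwd : ∀ s ∈ Ioc (0 : ℝ) 1,
        HasDerivWithinAt w ((h s - (a s + p' s) * w s) / p s) (Icc 0 1) s := by
      intro s hs
      have hs' : s ∈ Icc (0 : ℝ) 1 := ⟨hs.1.le, hs.2⟩
      have hps := (hppos s hs).ne'
      refine (((hqI s hs).div (hpI s hs') hps).congr_of_eventuallyEq (hIoc s hs)
        (hwI s hs)).congr_deriv ?_
      rw [hwI s hs]
      field_simp
      ring
    have hwc : ContinuousOn w (Icc 0 1) := by
      intro s hs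
      rcases eq_or_lt_of_le hs.1 with rfl | hpos
      · have h1 : Tendsto w (𝓝[>] 0) (𝓝 (w 0)) := by
          rw [hw0]
          refine hlim.congr' ?_
          filter_upwards [Ioo_mem_nhdsGT (one_pos : (0 : ℝ) < 1)] with s hs
          exact (hwI s ⟨hs.1, hs.2.le⟩).symm
        exact (continuousWithinAt_Ioi_iff_Ici.1 h1).mono Icc_subset_Ici_self
      · exact (hwd s ⟨hpos, hs.2⟩).continuousWithinAt
    have hwk : ContDiffOn ℝ k w (Icc 0 1) := by
      refine ih (p := p) (a := fun s => a s + p' s) (f := h) (hp.of_le hk)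
        ((ha.of_le hk).add hp') hh hp0 hpd hp₀ hppos (by simpa [add_comm] using hsum) ?_ hwc hwd
      rw [hw0, ← hc]
      ring
    rw [Nat.cast_add, Nat.cast_one, contDiffOn_succ_iff_derivWithin hU]
    exact ⟨hyD, by simp, hwk⟩

end EYM

/-! ### Existence near zero coupling by the inverse function theorem. -/

namespace EYM

open Topology unitInterval

/-- The averaging operator `f ↦ (t ↦ ∫₀¹ f(ts) ds)` on continuous functions on `[0, 1]`. -/
noncomputable def avg : C(I, ℝ) →L[ℝ] C(I, ℝ) :=
  LinearMap.mkContinuous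
    { toFun := fun f => ⟨fun t => ∫ s in (0 : ℝ)..1, f (t * projIcc 0 1 zero_le_one s), by
        refine intervalIntegral.continuous_parametric_intervalIntegral_of_continuous' ?_ 0 1
        have : Continuous (projIcc (0 : ℝ) 1 zero_le_one) := continuous_projIcc
        fun_prop⟩
      map_add' := fun f g => by
        ext t
        have : Continuous (projIcc (0 : ℝ) 1 zero_le_one) := continuous_projIcc
        exact intervalIntegral.integral_add
          (Continuous.intervalIntegrable (by fun_prop) _ _)
          (Continuous.intervalIntegrable (by fun_prop) _ _)
      map_smul' := fun c f => by
        ext t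
        simp }
    1 (fun f => by
      rw [one_mul, ContinuousMap.norm_le _ (norm_nonneg f)]
      intro t
      have := intervalIntegral.norm_integral_le_of_norm_le_const (a := 0) (b := 1)
        (f := fun s => f (t * projIcc 0 1 zero_le_one s)) (C := ‖f‖)
        (fun s _ => f.norm_coe_le_norm _)
      simpa using this)

/-- Substitution in the integral; thus `avg f` is the primitive of `f` divided by `t`, with no
singularity at `t = 0`. -/
theorem mul_avg (f : C(I, ℝ)) (t : I) :
    (t : ℝ) * avg f t = ∫ s in (0 : ℝ)..t, IccExtend zero_le_one f s := by
  have h := intervalIntegral.mul_integral_comp_mul_left (f := IccExtend zero_le_one f)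
    (a := 0) (b := 1) (c := (t : ℝ))
  rw [mul_zero, mul_one] at h
  rw [← h]
  congr 1
  refine intervalIntegral.integral_congr fun s hs => ?_
  rw [uIcc_of_le zero_le_one] at hs
  have hts : (t : ℝ) * s ∈ Icc (0 : ℝ) 1 := (t * ⟨s, hs⟩ : I).2
  rw [projIcc_of_mem _ hs, IccExtend_of_mem _ _ hts]
  rfl

theorem hasStrictFDerivAt_mul_zero {E A : Type*} [NormedAddCommGroup E] [NormedSpace ℝ E]
    [NormedCommRing A] [NormedAlgebra ℝ A] {f g : E → A} {x : E}
    (hf : ContDiff ℝ 1 f) (hg : ContDiff ℝ 1 g) (hf0 : f x = 0) (hg0 : g x = 0) :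
    HasStrictFDerivAt (fun z => f z * g z) (0 : E →L[ℝ] A) x := by
  have h1 := hf.contDiffAt.hasStrictFDerivAt (x := x) one_ne_zero
  have h2 := hg.contDiffAt.hasStrictFDerivAt (x := x) one_ne_zero
  refine (h1.mul h2).congr_fderiv ?_
  ext v
  simp [hf0, hg0]

/-- A coupling parameter `κ` together with two unknown functions on `[0, 1]`. -/
abbrev Data := ℝ × C(I, ℝ) × C(I, ℝ)

/-- The coordinate function `t`. -/
def coordT : C(I, ℝ) := ⟨fun t => t, by fun_prop⟩
/-- The function `1 - t`. -/
def coordY : C(I, ℝ) := ⟨fun t => 1 - t, by fun_prop⟩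
/-- The reciprocal of `(1 + y + y²) / 3` with `y = 1 - t`, the value of `quotP` at zero coupling. -/
noncomputable def rho : C(I, ℝ) := ⟨fun t => 3 / (1 + (1 - t) + (1 - t) ^ 2), by
  refine Continuous.div (by fun_prop) (by fun_prop) fun t => ?_
  have := t.2.2
  positivity⟩

/-- The derivative of the gauge field `ω` in the compactified coordinate. -/
noncomputable def fieldV (z : Data) : C(I, ℝ) := rho * z.2.1
/-- The gauge field with derivative `fieldV` and horizon value `ωh`. -/
noncomputable def fieldW (ωh : ℝ) (z : Data) : C(I, ℝ) :=
  algebraMap ℝ _ ωh + coordT * avg (fieldV z)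
/-- The deviation of `quotP` from its value at zero coupling. -/
noncomputable def corrP (z : Data) : C(I, ℝ) :=
  z.1 ^ 2 • coordY ^ 2 - (2 : ℝ) • coordY ^ 3 * avg z.2.2
/-- The rescaled metric function divided by `t`. -/
noncomputable def quotP (z : Data) : C(I, ℝ) :=
  (3⁻¹ : ℝ) • (1 + coordY + coordY ^ 2) + corrP z
/-- The right-hand side of the Yang-Mills equation in divergence form. -/
noncomputable def forceV (β ωh : ℝ) (z : Data) : C(I, ℝ) :=
  -((2 * β) • coordY ^ 3 * coordT * quotP z * fieldV z) * (fieldV z) ^ 2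
    - z.1 ^ 2 • ((1 - fieldW ωh z ^ 2) * fieldW ωh z)
/-- The right-hand side of the mass equation. -/
noncomputable def forceM (β ωh : ℝ) (z : Data) : C(I, ℝ) :=
  (β • coordT * quotP z * fieldV z) * fieldV z
    + z.1 ^ 2 • ((β / 2) • (fieldW ωh z ^ 2 - 1) ^ 2)

/-- Zeros of the last two components are solutions with coupling `ε = κ²`; the derivative at the
origin is the identity. -/
noncomputable def residualMap (β ωh : ℝ) (z : Data) : Data :=
  (z.1, z.2.1 + corrP z * fieldV z - avg (forceV β ωh z), z.2.2 - forceM β ωh z)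

/-- The factor `rho` in `fieldV` cancels the zero-coupling part of `quotP`; this makes the linear
part of the residual the identity. -/
theorem quotP_mul_fieldV (z : Data) :
    quotP z * fieldV z = z.2.1 + corrP z * fieldV z := by
  have : ((3⁻¹ : ℝ) • (1 + coordY + coordY ^ 2)) * rho = 1 := by
    ext t
    have := t.2.2
    have : 1 + (1 - (t : ℝ)) + (1 - (t : ℝ)) ^ 2 ≠ 0 := by positivity
    simp [coordY, rho]
    field_simp
  rw [quotP, add_mul]
  congr 1
  rw [fieldV, ← mul_assoc, this, one_mul]

theorem contDiff_fieldV : ContDiff ℝ 1 fieldV := by unfold fieldV; fun_prop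
theorem contDiff_fieldW (ωh : ℝ) : ContDiff ℝ 1 (fieldW ωh) := by
  have := contDiff_fieldV
  unfold fieldW; fun_prop
theorem contDiff_corrP : ContDiff ℝ 1 corrP := by unfold corrP; fun_prop
theorem contDiff_quotP : ContDiff ℝ 1 quotP := by
  have := contDiff_corrP
  unfold quotP; fun_prop

theorem fieldV_zero : fieldV 0 = 0 := by simp [fieldV]
theorem corrP_zero : corrP 0 = 0 := by simp [corrP]

/-- Split as `κ · (κ g)`, both factors vanish at the origin. This is the reason for using `κ = √ε`
as parameter: with `ε` itself the derivative would contain a source term. -/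
theorem hasStrictFDerivAt_sq_smul {g : Data → C(I, ℝ)} (hg : ContDiff ℝ 1 g) :
    HasStrictFDerivAt (fun z : Data => z.1 ^ 2 • g z) (0 : Data →L[ℝ] C(I, ℝ)) 0 := by
  have := hasStrictFDerivAt_mul_zero (f := fun z : Data => algebraMap ℝ C(I, ℝ) z.1)
    (g := fun z : Data => z.1 • g z) (x := 0)
    ((algebraMapCLM ℝ C(I, ℝ)).contDiff.comp contDiff_fst) (by fun_prop) (by simp) (by simp)
  simpa only [← Algebra.smul_def, smul_smul, ← sq] using this

theorem hasStrictFDerivAt_residualMap (β ωh : ℝ) :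
    HasStrictFDerivAt (residualMap β ωh) (ContinuousLinearEquiv.refl ℝ Data : Data →L[ℝ] Data) 0 := by
  have hV := contDiff_fieldV
  have hW := contDiff_fieldW ωh
  have hC := contDiff_corrP
  have hP := contDiff_quotP
  have h1 : HasStrictFDerivAt (fun z => corrP z * fieldV z) (0 : Data →L[ℝ] C(I, ℝ)) 0 :=
    hasStrictFDerivAt_mul_zero hC hV corrP_zero fieldV_zero
  have h2 : HasStrictFDerivAt (forceV β ωh) (0 : Data →L[ℝ] C(I, ℝ)) 0 := by
    have a := hasStrictFDerivAt_mul_zero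
      (f := fun z => -((2 * β) • coordY ^ 3 * coordT * quotP z * fieldV z))
      (g := fun z => fieldV z ^ 2) (x := 0) (by fun_prop) (by fun_prop)
      (by simp [fieldV_zero]) (by simp [fieldV_zero])
    have b := hasStrictFDerivAt_sq_smul (g := fun z => (1 - fieldW ωh z ^ 2) * fieldW ωh z)
      (by fun_prop)
    exact (a.sub b).congr_fderiv (sub_zero _)
  have h3 : HasStrictFDerivAt (forceM β ωh) (0 : Data →L[ℝ] C(I, ℝ)) 0 := by
    have a := hasStrictFDerivAt_mul_zero
      (f := fun z => β • coordT * quotP z * fieldV z)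
      (g := fieldV) (x := 0) (by fun_prop) (by fun_prop)
      (by simp [fieldV_zero]) (by simp [fieldV_zero])
    have b := hasStrictFDerivAt_sq_smul (g := fun z => (β / 2) • (fieldW ωh z ^ 2 - 1) ^ 2)
      (by fun_prop)
    exact (a.add b).congr_fderiv (add_zero _)
  have h4 := (ContinuousLinearMap.hasStrictFDerivAt avg (x := forceV β ωh 0)).comp (0 : Data) h2
  have e1 := (ContinuousLinearMap.fst ℝ ℝ (C(I, ℝ) × C(I, ℝ))).hasStrictFDerivAt (x := 0)
  have e := (ContinuousLinearMap.snd ℝ ℝ (C(I, ℝ) × C(I, ℝ))).hasStrictFDerivAt (x := 0)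
  have e2 := (ContinuousLinearMap.fst ℝ C(I, ℝ) C(I, ℝ)).hasStrictFDerivAt.comp (0 : Data) e
  have e3 := (ContinuousLinearMap.snd ℝ C(I, ℝ) C(I, ℝ)).hasStrictFDerivAt.comp (0 : Data) e
  refine (e1.prodMk (((e2.add h1).sub h4).prodMk (e3.sub h3))).congr_fderiv ?_
  ext z <;> simp

theorem residualMap_zero (β ωh : ℝ) : residualMap β ωh 0 = 0 := by
  simp [residualMap, corrP_zero, fieldV_zero, forceV, forceM]

/-- An invertible strict derivative maps neighbourhoods of the origin onto neighbourhoods, so `(κ,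
0, 0)` is the residual of some `z` near the origin. Closeness to the origin keeps `quotP` positive
and `fieldW` nonzero. -/
theorem exists_continuousMap_solution (β ωh : ℝ) (hωh : ωh ≠ 0) :
    ∃ κ₀ > 0, ∀ κ, 0 < κ → κ < κ₀ → ∃ z : Data, z.1 = κ ∧
      quotP z * fieldV z = avg (forceV β ωh z) ∧ z.2.2 = forceM β ωh z ∧
      (∀ t, 0 < quotP z t) ∧ ∀ t, fieldW ωh z t ≠ 0 := by
  have hmap := (hasStrictFDerivAt_residualMap β ωh).map_nhds_eq_of_equiv
  rw [residualMap_zero] at hmap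
  -- The radius `1/3` is the minimum of `quotP 0 = (1 + y + y²) / 3`, attained at `y = 0`.
  have hP : ∀ᶠ z in 𝓝 (0 : Data), dist (quotP z) (quotP 0) < 3⁻¹ :=
    contDiff_quotP.continuous.continuousAt.eventually (Metric.ball_mem_nhds _ (by norm_num))
  have hW : ∀ᶠ z in 𝓝 (0 : Data), dist (fieldW ωh z) (fieldW ωh 0) < |ωh| :=
    (contDiff_fieldW ωh).continuous.continuousAt.eventually
      (Metric.ball_mem_nhds _ (abs_pos.2 hωh))
  have himg : residualMap β ωh '' {z | dist (quotP z) (quotP 0) < 3⁻¹ ∧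
      dist (fieldW ωh z) (fieldW ωh 0) < |ωh|} ∈ 𝓝 (0 : Data) := by
    rw [← hmap]
    exact image_mem_map (hP.and hW)
  have hcont : Tendsto (fun κ : ℝ => ((κ, 0, 0) : Data)) (𝓝 0) (𝓝 0) := by
    have : Continuous (fun κ : ℝ => ((κ, 0, 0) : Data)) := by fun_prop
    exact this.tendsto 0
  obtain ⟨κ₀, hκ₀, hball⟩ := Metric.mem_nhds_iff.1 (hcont himg)
  refine ⟨κ₀, hκ₀, fun κ hκ hκκ => ?_⟩
  obtain ⟨z, ⟨hz1, hz2⟩, hz⟩ := hball (show κ ∈ Metric.ball 0 κ₀ by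
    simpa [abs_of_pos hκ] using hκκ)
  simp only [residualMap, Prod.mk.injEq] at hz
  obtain ⟨ha, hb, hc⟩ := hz
  refine ⟨z, ha, ?_, sub_eq_zero.1 hc, fun t => ?_, fun t => ?_⟩
  · rw [quotP_mul_fieldV]
    exact sub_eq_zero.1 hb
  · have := (ContinuousMap.dist_apply_le_dist (f := quotP z) (g := quotP 0) t).trans_lt hz1
    rw [Real.dist_eq, abs_lt] at this
    have h0 : (3⁻¹ : ℝ) ≤ quotP 0 t := by
      have := t.2.2
      simp [quotP, corrP_zero, coordY]
      nlinarith
    linarith [this.1]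
  · have := (ContinuousMap.dist_apply_le_dist (f := fieldW ωh z) (g := fieldW ωh 0) t).trans_lt hz2
    have h0 : fieldW ωh 0 t = ωh := by simp [fieldW, fieldV_zero]
    rw [Real.dist_eq, h0] at this
    intro h
    simp [h] at this

end EYM

/-! ### The compactified field equations. -/

namespace EYM

open Topology unitInterval

/-- The rescaled metric function `N / (|Λ| r²)` in the coordinate `t = 1 - rh / r`. -/
noncomputable def reducedP (ε : ℝ) (M : ℝ → ℝ) (t : ℝ) : ℝ :=
  1 / 3 + ε * (1 - t) ^ 2 - 2 * M t * (1 - t) ^ 3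

/-- The field equations in the compactified coordinate `t = 1 - rh / r ∈ [0, 1]`, where
`β = 1 / rh²`, `ε = 1 / (|Λ| rh²)`, `M = m / (|Λ| rh³)` and `v = dω/dt`. -/
structure ReducedSolution (β ε ωh : ℝ) (v ω M : ℝ → ℝ) : Prop where
  continuousOn_v : ContinuousOn v (Icc 0 1)
  deriv_ω : ∀ t ∈ Icc (0 : ℝ) 1, HasDerivWithinAt ω (v t) (Icc 0 1) t
  deriv_M : ∀ t ∈ Icc (0 : ℝ) 1, HasDerivWithinAt M
    (β * (reducedP ε M t * v t ^ 2 + ε * (ω t ^ 2 - 1) ^ 2 / 2)) (Icc 0 1) t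
  deriv_pv : ∀ t ∈ Icc (0 : ℝ) 1, HasDerivWithinAt (fun t => reducedP ε M t * v t)
    (-(2 * β * (1 - t) ^ 3 * reducedP ε M t * v t ^ 3) - ε * ((1 - ω t ^ 2) * ω t)) (Icc 0 1) t
  M_zero : M 0 = 1 / 6 + ε / 2
  ω_zero : ω 0 = ωh
  p_pos : ∀ t ∈ Ioc (0 : ℝ) 1, 0 < reducedP ε M t
  ω_ne : ∀ t ∈ Icc (0 : ℝ) 1, ω t ≠ 0
  nondegenerate : β * ε * (ωh ^ 2 - 1) ^ 2 < 1 + ε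

theorem hasDerivAt_integral_IccExtend (f : C(I, ℝ)) (t : ℝ) :
    HasDerivAt (fun t => ∫ s in (0 : ℝ)..t, IccExtend zero_le_one f s)
      (IccExtend zero_le_one f t) t :=
  (f.continuous.Icc_extend' (h := zero_le_one)).integral_hasStrictDerivAt 0 t |>.hasDerivAt

theorem reducedSolution_of_continuousMap {β ωh : ℝ} {z : Data}
    (hV : quotP z * fieldV z = avg (forceV β ωh z)) (hM : z.2.2 = forceM β ωh z)
    (hp : ∀ t, 0 < quotP z t) (hω : ∀ t, fieldW ωh z t ≠ 0)
    (hnd : β * z.1 ^ 2 * (ωh ^ 2 - 1) ^ 2 < 1 + z.1 ^ 2) :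
    ReducedSolution β (z.1 ^ 2) ωh (IccExtend zero_le_one (fieldV z))
      (fun t => ωh + ∫ s in (0 : ℝ)..t, IccExtend zero_le_one (fieldV z) s)
      (fun t => 1 / 6 + z.1 ^ 2 / 2 + ∫ s in (0 : ℝ)..t, IccExtend zero_le_one z.2.2 s) := by
  set v := IccExtend zero_le_one (fieldV z) with hv
  set ω := fun t => ωh + ∫ s in (0 : ℝ)..t, v s with hωdef
  set M := fun t => 1 / 6 + z.1 ^ 2 / 2 + ∫ s in (0 : ℝ)..t, IccExtend zero_le_one z.2.2 s
    with hMdef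
  have eω : ∀ t : I, ω t = fieldW ωh z t := fun t => by
    simp only [hωdef, hv, ← mul_avg, fieldW]
    simp [coordT]
  have ep : ∀ t : I, reducedP (z.1 ^ 2) M t = t * quotP z t := fun t => by
    simp only [reducedP, hMdef, ← mul_avg, quotP, corrP, coordY]
    simp
    ring
  have ev : ∀ t : I, v t = fieldV z t := fun t => IccExtend_val _ _ _
  refine ⟨(fieldV z).continuous.Icc_extend'.continuousOn, fun t ht => ?_, fun t ht => ?_,
    fun t ht => ?_, by simp [hMdef], by simp [hωdef], fun t ht => ?_, fun t ht => ?_, hnd⟩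
  · exact ((hasDerivAt_integral_IccExtend _ t).const_add _).hasDerivWithinAt
  · refine ((hasDerivAt_integral_IccExtend _ t).const_add _).hasDerivWithinAt.congr_deriv ?_
    have h1 := eω ⟨t, ht⟩
    have h2 := ep ⟨t, ht⟩
    have h3 := ev ⟨t, ht⟩
    simp only at h1 h2 h3
    rw [IccExtend_of_mem _ _ ht, h1, h2, h3]
    nth_rewrite 1 [hM]
    simp [forceM, coordT]
    ring
  · have heq : ∀ s ∈ Icc (0 : ℝ) 1, reducedP (z.1 ^ 2) M s * v s =
        ∫ x in (0 : ℝ)..s, IccExtend zero_le_one (forceV β ωh z) x := by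
      intro s hs
      have h := mul_avg (forceV β ωh z) ⟨s, hs⟩
      have h2 := ep ⟨s, hs⟩
      have h3 := ev ⟨s, hs⟩
      simp only at h h2 h3
      rw [← h, h2, h3, ← hV, ContinuousMap.mul_apply, mul_assoc]
    refine ((hasDerivAt_integral_IccExtend (forceV β ωh z) t).hasDerivWithinAt.congr heq
      (heq t ht)).congr_deriv ?_
    have h1 := eω ⟨t, ht⟩
    have h2 := ep ⟨t, ht⟩
    have h3 := ev ⟨t, ht⟩
    simp only at h1 h2 h3
    rw [IccExtend_of_mem _ _ ht, h1, h2, h3]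
    simp [forceV, coordT, coordY]
    ring
  · have h2 := ep ⟨t, ht.1.le, ht.2⟩
    simp only at h2
    rw [h2]
    exact mul_pos ht.1 (hp _)
  · have h1 := eω ⟨t, ht⟩
    simp only at h1
    rw [h1]
    exact hω _

theorem exists_reducedSolution (β ωh : ℝ) (hωh : ωh ≠ 0) :
    ∃ ε₀ > 0, ∀ ε, 0 < ε → ε < ε₀ → ∃ v ω M, ReducedSolution β ε ωh v ω M := by
  obtain ⟨κ₀, hκ₀, H⟩ := exists_continuousMap_solution β ωh hωh
  set b := |β * (ωh ^ 2 - 1) ^ 2|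
  have hb : 0 < b + 1 := by positivity
  -- The second bound secures `nondegenerate`, that is `p'(0) > 0`.
  refine ⟨min (κ₀ ^ 2) (1 / (b + 1)), by positivity, fun ε hε hεε => ?_⟩
  obtain ⟨z, hz, hV, hM, hp, hω⟩ := H (√ε) (Real.sqrt_pos.2 hε)
    ((Real.sqrt_lt' hκ₀).2 (hεε.trans_le (min_le_left _ _)))
  have hz2 : z.1 ^ 2 = ε := by rw [hz, Real.sq_sqrt hε.le]
  have h1 : ε * (b + 1) < 1 := (lt_div_iff₀ hb).1 (hεε.trans_le (min_le_right _ _))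
  have h2 := le_abs_self (β * (ωh ^ 2 - 1) ^ 2)
  have h := reducedSolution_of_continuousMap hV hM hp hω (by rw [hz2]; nlinarith)
  rw [hz2] at h
  exact ⟨_, _, _, h⟩

/-! ### Smoothness of compactified solutions up to both endpoints. -/

namespace ReducedSolution

variable {β ε ωh : ℝ} {v ω M : ℝ → ℝ}

theorem p_zero (h : ReducedSolution β ε ωh v ω M) : reducedP ε M 0 = 0 := by
  rw [reducedP, h.M_zero]
  ring

theorem deriv_p (h : ReducedSolution β ε ωh v ω M) {t : ℝ} (ht : t ∈ Icc (0 : ℝ) 1) :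
    HasDerivWithinAt (reducedP ε M) (6 * M t * (1 - t) ^ 2 - 2 * ε * (1 - t) - 2 * (1 - t) ^ 3 *
      (β * (reducedP ε M t * v t ^ 2 + ε * (ω t ^ 2 - 1) ^ 2 / 2))) (Icc 0 1) t := by
  have h1 : HasDerivWithinAt (fun s : ℝ => 1 - s) (-1) (Icc 0 1) t :=
    (hasDerivAt_id t).const_sub 1 |>.hasDerivWithinAt
  have := (((h1.pow 2).const_mul ε).const_add (1 / 3)).sub
    (((h.deriv_M t ht).const_mul 2).mul (h1.pow 3))
  refine this.congr_deriv ?_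
  simp
  ring

theorem deriv_p_zero_pos (h : ReducedSolution β ε ωh v ω M) :
    0 < 6 * M 0 * (1 - 0) ^ 2 - 2 * ε * (1 - 0) - 2 * (1 - 0) ^ 3 *
      (β * (reducedP ε M 0 * v 0 ^ 2 + ε * (ω 0 ^ 2 - 1) ^ 2 / 2)) := by
  rw [h.p_zero, h.M_zero, h.ω_zero]
  linarith [h.nondegenerate]

/-- The coefficient of `v` in the singular equation `p v' = -g v - ε (1 - ω²) ω`. -/
noncomputable def coeff (β ε : ℝ) (ω M : ℝ → ℝ) (t : ℝ) : ℝ :=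
  6 * M t * (1 - t) ^ 2 - 2 * ε * (1 - t) - β * ε * (1 - t) ^ 3 * (ω t ^ 2 - 1) ^ 2

/-- Expanding `(p v)'`, the cubic term cancels against the `p v²` term of `p'`, so the equation is
linear in `v` with coefficients depending only on `ω` and `M`. -/
theorem mul_deriv_v (h : ReducedSolution β ε ωh v ω M) {t v' : ℝ} (ht : t ∈ Icc (0 : ℝ) 1)
    (hv : HasDerivWithinAt v v' (Icc 0 1) t) :
    reducedP ε M t * v' = -(ε * ((1 - ω t ^ 2) * ω t)) - coeff β ε ω M t * v t := by
  have := (uniqueDiffOn_Icc one_pos t ht).eq_deriv _ ((h.deriv_p ht).mul hv) (h.deriv_pv t ht)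
  unfold coeff
  linear_combination this

theorem deriv_v (h : ReducedSolution β ε ωh v ω M) {t : ℝ} (ht : t ∈ Ioc (0 : ℝ) 1) :
    HasDerivWithinAt v ((-(ε * ((1 - ω t ^ 2) * ω t)) - coeff β ε ω M t * v t) / reducedP ε M t)
      (Icc 0 1) t := by
  have ht' : t ∈ Icc (0 : ℝ) 1 := ⟨ht.1.le, ht.2⟩
  have hp := (h.p_pos t ht).ne'
  have hd := (h.deriv_pv t ht').div (h.deriv_p ht') hp
  have hd' := hd.congr_of_eventuallyEq (f₁ := v) (by
    filter_upwards [self_mem_nhdsWithin, mem_nhdsWithin_of_mem_nhds (Ioi_mem_nhds ht.1)]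
      with s hs hs0
    exact (mul_div_cancel_left₀ _ (h.p_pos s ⟨hs0, hs.2⟩).ne').symm)
    (mul_div_cancel_left₀ _ hp).symm
  refine hd'.congr_deriv ?_
  rw [← h.mul_deriv_v ht' hd', mul_div_cancel_left₀ _ hp]

/-- The compatibility condition at the horizon. Since `p 0 = 0`, difference quotients give `(p
v)'(0) = p'(0) v(0)` from continuity of `v` alone. -/
theorem coeff_zero_mul (h : ReducedSolution β ε ωh v ω M) :
    coeff β ε ω M 0 * v 0 = -(ε * ((1 - ω 0 ^ 2) * ω 0)) := by
  have h0 : (0 : ℝ) ∈ Icc (0 : ℝ) 1 := by simp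
  have hlim : ∀ {f : ℝ → ℝ}, ContinuousOn f (Icc 0 1) → Tendsto f (𝓝[>] 0) (𝓝 (f 0)) :=
    fun hf => by
      have := hf 0 h0
      rw [ContinuousWithinAt, nhdsWithin_Icc_eq_nhdsGE one_pos] at this
      exact this.mono_left (nhdsWithin_mono _ Ioi_subset_Ici_self)
  have h1 := (hasDerivWithinAt_iff_tendsto_slope.1 (h.deriv_pv 0 h0)).mono_left
    (nhdsWithin_mono _ (t := Icc 0 1 \ {0}) (s := Ioo 0 1) fun x hx => ⟨⟨hx.1.le, hx.2.le⟩, hx.1.ne'⟩)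
  have h2 := (hasDerivWithinAt_iff_tendsto_slope.1 (h.deriv_p h0)).mono_left
    (nhdsWithin_mono _ (t := Icc 0 1 \ {0}) (s := Ioo 0 1) fun x hx => ⟨⟨hx.1.le, hx.2.le⟩, hx.1.ne'⟩)
  rw [nhdsWithin_Ioo_eq_nhdsGT one_pos] at h1 h2
  have h3 := tendsto_nhds_unique h1 ((h2.mul (hlim h.continuousOn_v)).congr fun s => by
    simp only [slope_def_field, h.p_zero]
    ring)
  rw [h.p_zero] at h3
  unfold coeff
  linear_combination -h3

/-- Bootstrap: if `v`, `ω`, `M` are `C^k`, the first-order equations make `ω` and `M` of class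
`C^(k+1)`, hence also `p` and `coeff`, and singular regularity lifts `v`. -/
theorem contDiffOn_nat (h : ReducedSolution β ε ωh v ω M) (k : ℕ) :
    ContDiffOn ℝ k v (Icc 0 1) ∧ ContDiffOn ℝ k ω (Icc 0 1) ∧ ContDiffOn ℝ k M (Icc 0 1) := by
  induction k with
  | zero =>
    simp only [Nat.cast_zero, contDiffOn_zero]
    exact ⟨h.continuousOn_v, fun t ht => (h.deriv_ω t ht).continuousWithinAt,
      fun t ht => (h.deriv_M t ht).continuousWithinAt⟩
  | succ k ih =>
    obtain ⟨hv, hω, hM⟩ := ih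
    have hU : UniqueDiffOn ℝ (Icc (0 : ℝ) 1) := uniqueDiffOn_Icc one_pos
    have step : ∀ {f g : ℝ → ℝ}, (∀ t ∈ Icc (0 : ℝ) 1, HasDerivWithinAt f (g t) (Icc 0 1) t) →
        ContDiffOn ℝ k g (Icc 0 1) → ContDiffOn ℝ (k + 1 : ℕ) f (Icc 0 1) := by
      intro f g hf hg
      rw [Nat.cast_add, Nat.cast_one, contDiffOn_succ_iff_derivWithin hU]
      exact ⟨fun t ht => (hf t ht).differentiableWithinAt, by simp,
        hg.congr fun t ht => (hf t ht).derivWithin (hU t ht)⟩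
    have hω' : ContDiffOn ℝ (k + 1 : ℕ) ω (Icc 0 1) := step h.deriv_ω hv
    have hM' : ContDiffOn ℝ (k + 1 : ℕ) M (Icc 0 1) := by
      refine step h.deriv_M ?_
      unfold reducedP
      fun_prop
    have hp : ContDiffOn ℝ (k + 1 : ℕ) (reducedP ε M) (Icc 0 1) := by
      unfold reducedP
      fun_prop
    refine ⟨contDiffOn_of_singular_linear (k + 1) hp (a := coeff β ε ω M)
      (f := fun t => -(ε * ((1 - ω t ^ 2) * ω t))) ?_ (by fun_prop) h.p_zero
      (h.deriv_p (by simp)) h.deriv_p_zero_pos h.p_pos ?_ h.coeff_zero_mul h.continuousOn_v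
      fun t ht => h.deriv_v ht, hω', hM'⟩
    · unfold coeff
      fun_prop
    · rw [coeff, h.M_zero, h.ω_zero]
      linarith [h.nondegenerate]

theorem contDiffOn (h : ReducedSolution β ε ωh v ω M) :
    ContDiffOn ℝ ((⊤ : ℕ∞) : WithTop ℕ∞) v (Icc 0 1) ∧
    ContDiffOn ℝ ((⊤ : ℕ∞) : WithTop ℕ∞) ω (Icc 0 1) ∧
    ContDiffOn ℝ ((⊤ : ℕ∞) : WithTop ℕ∞) M (Icc 0 1) :=
  ⟨contDiffOn_infty.2 fun k => (h.contDiffOn_nat k).1,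
    contDiffOn_infty.2 fun k => (h.contDiffOn_nat k).2.1,
    contDiffOn_infty.2 fun k => (h.contDiffOn_nat k).2.2⟩

end ReducedSolution

end EYM

/-! ### Return to the radial coordinate, and asymptotics at infinity. -/

namespace EYM

open Topology

/-- The compactified radial coordinate. -/
noncomputable def compactCoord (rh r : ℝ) : ℝ := 1 - rh / r

theorem compactCoord_mem {rh r : ℝ} (hrh : 0 < rh) (hr : rh ≤ r) :
    compactCoord rh r ∈ Icc (0 : ℝ) 1 := by
  have hr0 : 0 < r := hrh.trans_le hr
  have h1 : rh / r ≤ 1 := (div_le_one hr0).2 hr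
  have h2 : 0 < rh / r := by positivity
  constructor <;> unfold compactCoord <;> linarith

theorem compactCoord_pos {rh r : ℝ} (hrh : 0 < rh) (hr : rh < r) : 0 < compactCoord rh r := by
  have h1 : rh / r < 1 := (div_lt_one (hrh.trans hr)).2 hr
  unfold compactCoord
  linarith

theorem compactCoord_self {rh : ℝ} (hrh : 0 < rh) : compactCoord rh rh = 0 := by
  simp [compactCoord, div_self hrh.ne']

theorem hasDerivAt_compactCoord {rh r : ℝ} (hr : r ≠ 0) :
    HasDerivAt (compactCoord rh) (rh / r ^ 2) r := by
  have := ((hasDerivAt_inv hr).const_mul rh).const_sub 1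
  refine (this.congr_deriv ?_).congr_of_eventuallyEq (Eventually.of_forall fun s => ?_)
  · field_simp
  · simp [compactCoord, div_eq_mul_inv]

theorem hasDerivWithinAt_comp_compactCoord {f : ℝ → ℝ} {f' rh r : ℝ} (hrh : 0 < rh) (hr : rh ≤ r)
    (hf : HasDerivWithinAt f f' (Icc 0 1) (compactCoord rh r)) :
    HasDerivWithinAt (fun s => f (compactCoord rh s)) (f' * (rh / r ^ 2)) (Ici rh) r :=
  hf.comp r (hasDerivAt_compactCoord (hrh.trans_le hr).ne').hasDerivWithinAt
    fun _ hs => compactCoord_mem hrh hs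

theorem radialDeriv_comp_compactCoord {f : ℝ → ℝ} {f' rh r : ℝ} (hrh : 0 < rh) (hr : rh ≤ r)
    (hf : HasDerivWithinAt f f' (Icc 0 1) (compactCoord rh r)) :
    radialDeriv rh (fun s => f (compactCoord rh s)) r = f' * (rh / r ^ 2) :=
  (hasDerivWithinAt_comp_compactCoord hrh hr hf).derivWithin (uniqueDiffOn_Ici rh r hr)

theorem contDiffOn_comp_compactCoord {f : ℝ → ℝ} {rh : ℝ} (hrh : 0 < rh)
    (hf : ContDiffOn ℝ ((⊤ : ℕ∞) : WithTop ℕ∞) f (Icc 0 1)) :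
    ContDiffOn ℝ ((⊤ : ℕ∞) : WithTop ℕ∞) (fun r => f (compactCoord rh r)) (Ici rh) := by
  refine hf.comp ?_ fun r hr => compactCoord_mem hrh hr
  unfold compactCoord
  exact contDiffOn_const.sub (contDiffOn_const.div contDiffOn_id
    fun r hr => (hrh.trans_le hr).ne')

theorem isBigO_sub_taylor_div {φ : ℝ → ℝ} {n : ℕ} {rh : ℝ} (hrh : 0 < rh)
    (hφ : ContDiffOn ℝ (n + 1 : ℕ) φ (Icc 0 1)) :
    (fun r => φ (rh / r) - taylorWithinEval φ n (Icc 0 1) 0 (rh / r))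
      =O[atTop] (fun r => 1 / r ^ (n + 1)) := by
  obtain ⟨C, hC⟩ := exists_taylor_mean_remainder_bound (n := n) zero_le_one (by exact_mod_cast hφ)
  refine IsBigO.of_bound (C * rh ^ (n + 1)) ?_
  filter_upwards [eventually_ge_atTop rh] with r hr
  have hr0 : 0 < r := hrh.trans_le hr
  have := hC (rh / r) ⟨by positivity, (div_le_one hr0).2 hr⟩
  rw [sub_zero, div_pow] at this
  rw [Real.norm_of_nonneg (by positivity : 0 ≤ 1 / r ^ (n + 1))]
  exact this.trans_eq (by ring)

theorem hasDerivWithinAt_comp_one_sub {f : ℝ → ℝ} {f' t : ℝ}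
    (hf : HasDerivWithinAt f f' (Icc 0 1) (1 - t)) :
    HasDerivWithinAt (fun s => f (1 - s)) (-f') (Icc 0 1) t := by
  have := hf.comp t ((hasDerivAt_id t).const_sub 1).hasDerivWithinAt
    (fun s (hs : s ∈ Icc (0 : ℝ) 1) => (⟨by linarith [hs.2], by linarith [hs.1]⟩ : _ ∧ _))
  exact this.congr_deriv (by simp)

/-- Taylor expansion at `y = 0` of `y ↦ f (1 - y)`, with `y = rh / r`; the reflection flips the sign
of the first-order term. -/
theorem isBigO_expansion_two {f f₁ : ℝ → ℝ} {f₂ rh : ℝ} (hrh : 0 < rh)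
    (hf : ContDiffOn ℝ ((⊤ : ℕ∞) : WithTop ℕ∞) f (Icc 0 1))
    (h₁ : ∀ t ∈ Icc (0 : ℝ) 1, HasDerivWithinAt f (f₁ t) (Icc 0 1) t)
    (h₂ : HasDerivWithinAt f₁ f₂ (Icc 0 1) 1) :
    (fun r => f (compactCoord rh r) - f 1) =O[atTop] (fun r => 1 / r) ∧
    (fun r => f (compactCoord rh r) - (f 1 - f₁ 1 * (rh / r))) =O[atTop] (fun r => 1 / r ^ 2) ∧
    (fun r => f (compactCoord rh r) - (f 1 - f₁ 1 * (rh / r) + f₂ / 2 * (rh / r) ^ 2))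
      =O[atTop] (fun r => 1 / r ^ 3) := by
  have hU : UniqueDiffOn ℝ (Icc (0 : ℝ) 1) := uniqueDiffOn_Icc one_pos
  have h0 : (0 : ℝ) ∈ Icc (0 : ℝ) 1 := by simp
  have hmaps : ∀ s ∈ Icc (0 : ℝ) 1, 1 - s ∈ Icc (0 : ℝ) 1 :=
    fun s hs => ⟨by linarith [hs.2], by linarith [hs.1]⟩
  have hφ : ∀ n : ℕ, ContDiffOn ℝ n (fun y => f (1 - y)) (Icc 0 1) := fun n =>
    (contDiffOn_infty.1 hf n).comp (by fun_prop) hmaps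
  have d1 : ∀ t ∈ Icc (0 : ℝ) 1, derivWithin (fun y => f (1 - y)) (Icc 0 1) t = -f₁ (1 - t) :=
    fun t ht => (hasDerivWithinAt_comp_one_sub (h₁ _ (hmaps t ht))).derivWithin (hU t ht)
  have d2 : derivWithin (fun y => -f₁ (1 - y)) (Icc 0 1) 0 = f₂ := by
    have := (hasDerivWithinAt_comp_one_sub (f := f₁) (t := 0) (by simpa using h₂)).neg
    exact (this.derivWithin (hU 0 h0)).trans (neg_neg _)
  have i2 : iteratedDerivWithin 2 (fun y => f (1 - y)) (Icc 0 1) 0 = f₂ := by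
    rw [iteratedDerivWithin_succ, derivWithin_congr (f := fun y => -f₁ (1 - y)) ?_ ?_, d2]
    · exact fun t ht => by rw [iteratedDerivWithin_one, d1 t ht]
    · rw [iteratedDerivWithin_one, d1 0 h0]
  have i1 : iteratedDerivWithin 1 (fun y => f (1 - y)) (Icc 0 1) 0 = -f₁ 1 := by
    rw [iteratedDerivWithin_one, d1 0 h0, sub_zero]
  refine ⟨?_, ?_, ?_⟩
  · simpa [compactCoord] using isBigO_sub_taylor_div hrh (hφ 1)
  · refine (isBigO_sub_taylor_div hrh (hφ 2)).congr_left fun r => ?_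
    simp [compactCoord, taylorWithinEval_succ, i1, -iteratedDerivWithin_one]
    ring
  · refine (isBigO_sub_taylor_div hrh (hφ 3)).congr_left fun r => ?_
    simp [compactCoord, taylorWithinEval_succ, i1, i2, -iteratedDerivWithin_one]
    ring

theorem ReducedSolution.exists_lapse {β ε ωh : ℝ} {v ω M : ℝ → ℝ}
    (h : ReducedSolution β ε ωh v ω M) :
    ∃ σ : ℝ → ℝ, σ 1 = 0 ∧ ContDiffOn ℝ ((⊤ : ℕ∞) : WithTop ℕ∞) σ (Icc 0 1) ∧
      ∀ t ∈ Icc (0 : ℝ) 1, HasDerivWithinAt σ (2 * β * (1 - t) ^ 3 * v t ^ 2) (Icc 0 1) t := by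
  have hc := h.continuousOn_v
  have hcont : Continuous (IccExtend (zero_le_one (α := ℝ))
      ((Icc 0 1).domRestrict fun t => 2 * β * (1 - t) ^ 3 * v t ^ 2)) :=
    (continuousOn_iff_continuous_domRestrict.1 (by fun_prop)).Icc_extend'
  have hd : ∀ t ∈ Icc (0 : ℝ) 1, HasDerivWithinAt (fun t => ∫ s in (1 : ℝ)..t,
      IccExtend (zero_le_one (α := ℝ))
        ((Icc 0 1).domRestrict fun t => 2 * β * (1 - t) ^ 3 * v t ^ 2) s)
      (2 * β * (1 - t) ^ 3 * v t ^ 2) (Icc 0 1) t := fun t ht =>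
    (hcont.integral_hasStrictDerivAt 1 t).hasDerivAt.hasDerivWithinAt.congr_deriv
      (IccExtend_of_mem _ _ ht)
  have hU : UniqueDiffOn ℝ (Icc (0 : ℝ) 1) := uniqueDiffOn_Icc one_pos
  refine ⟨_, intervalIntegral.integral_same, ?_, hd⟩
  rw [contDiffOn_infty_iff_derivWithin hU]
  refine ⟨fun t ht => (hd t ht).differentiableWithinAt, ContDiffOn.congr ?_
    fun t ht => (hd t ht).derivWithin (hU t ht)⟩
  have := h.contDiffOn.1
  fun_prop

/-- A solution of the compactified system yields a black hole solution in the radial coordinate. -/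
theorem ReducedSolution.exists_isRegularBlackHole {Λ rh ωh : ℝ} {v ω M : ℝ → ℝ} (hrh : 0 < rh)
    (hΛ : Λ < 0) (h : ReducedSolution (1 / rh ^ 2) (-1 / (Λ * rh ^ 2)) ωh v ω M) :
    ∃ S, IsRegularBlackHole Λ rh ωh (fun r => -Λ * rh ^ 3 * M (compactCoord rh r)) S
      (fun r => ω (compactCoord rh r)) := by
  obtain ⟨σ, hσ1, hσ, hσd⟩ := h.exists_lapse
  obtain ⟨hv, hω, hM⟩ := h.contDiffOn
  set ε := -1 / (Λ * rh ^ 2) with hε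
  have hΛ0 : Λ ≠ 0 := hΛ.ne
  have hrh0 : rh ≠ 0 := hrh.ne'
  have hN : ∀ r, rh ≤ r → metricN Λ (fun r => -Λ * rh ^ 3 * M (compactCoord rh r)) r =
      -Λ * r ^ 2 * reducedP ε M (compactCoord rh r) := by
    intro r hr
    have hr0 : r ≠ 0 := (hrh.trans_le hr).ne'
    rw [metricN, reducedP, hε]
    generalize M (compactCoord rh r) = x
    rw [compactCoord]
    field_simp
    ring
  have hω' : ∀ r, rh ≤ r → radialDeriv rh (fun r => ω (compactCoord rh r)) r =
      v (compactCoord rh r) * (rh / r ^ 2) := fun r hr =>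
    radialDeriv_comp_compactCoord hrh hr (h.deriv_ω _ (compactCoord_mem hrh hr))
  have hUI : UniqueDiffOn ℝ (Ici rh) := uniqueDiffOn_Ici rh
  have hvd : ∀ t ∈ Icc (0 : ℝ) 1, HasDerivWithinAt v (derivWithin v (Icc 0 1) t) (Icc 0 1) t :=
    fun t ht => (hv.differentiableOn (by simp) t ht).hasDerivWithinAt
  have hω'' : ∀ r, rh ≤ r →
      radialDeriv rh (radialDeriv rh (fun r => ω (compactCoord rh r))) r =
        derivWithin v (Icc 0 1) (compactCoord rh r) * (rh / r ^ 2) * (rh / r ^ 2) +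
          v (compactCoord rh r) * (-2 * rh / r ^ 3) := by
    intro r hr
    have hr0 : r ≠ 0 := (hrh.trans_le hr).ne'
    have h1 := hasDerivWithinAt_comp_compactCoord hrh hr (hvd _ (compactCoord_mem hrh hr))
    have h2 : HasDerivAt (fun s : ℝ => rh / s ^ 2) (-2 * rh / r ^ 3) r := by
      refine ((hasDerivAt_const r rh).div (hasDerivAt_pow 2 r) (pow_ne_zero 2 hr0)).congr_deriv ?_
      field_simp
      simp
      ring
    exact ((h1.mul h2.hasDerivWithinAt).congr hω' (hω' r hr)).derivWithin (hUI r hr)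
  refine ⟨fun r => Real.exp (σ (compactCoord rh r)),
    ⟨contDiffOn_const.mul (contDiffOn_comp_compactCoord hrh hM),
     contDiffOn_comp_compactCoord hrh (f := fun t => Real.exp (σ t)) hσ.exp,
     contDiffOn_comp_compactCoord hrh hω, fun r _ => Real.exp_pos _, ⟨?_, ?_, ?_⟩, ?_, ?_, ?_, ?_,
     ?_⟩⟩
  · intro r hr
    have hr0 : r ≠ 0 := (hrh.trans_le hr).ne'
    have h1 := radialDeriv_comp_compactCoord hrh hr
      ((h.deriv_M _ (compactCoord_mem hrh hr)).const_mul (-Λ * rh ^ 3))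
    rw [h1, hN r hr, hω' r hr, hε]
    field_simp
    ring
  · intro r hr
    have hr0 : r ≠ 0 := (hrh.trans_le hr).ne'
    have h1 := radialDeriv_comp_compactCoord hrh hr (hσd _ (compactCoord_mem hrh hr)).exp
    rw [h1, hω' r hr]
    have := (Real.exp_pos (σ (compactCoord rh r))).ne'
    field_simp
    simp only [compactCoord]
    field_simp
    ring
  · intro r hr
    have hr0 : r ≠ 0 := (hrh.trans_le hr).ne'
    have ht := compactCoord_mem hrh hr
    have h1 := h.mul_deriv_v ht (hvd _ ht)
    rw [hN r hr, hω' r hr, hω'' r hr]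
    have e1 : r ^ 2 * (-Λ * r ^ 2 * reducedP ε M (compactCoord rh r)) *
        (derivWithin v (Icc 0 1) (compactCoord rh r) * (rh / r ^ 2) * (rh / r ^ 2) +
          v (compactCoord rh r) * (-2 * rh / r ^ 3)) =
        -Λ * rh ^ 2 * (reducedP ε M (compactCoord rh r) *
          derivWithin v (Icc 0 1) (compactCoord rh r)) +
        2 * Λ * rh * r * reducedP ε M (compactCoord rh r) * v (compactCoord rh r) := by
      field_simp
      ring
    rw [e1, h1, coeff, reducedP, hε]
    generalize M (compactCoord rh r) = x
    generalize v (compactCoord rh r) = y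
    generalize ω (compactCoord rh r) = z
    rw [compactCoord]
    field_simp
    ring
  · rw [hN rh le_rfl, compactCoord_self hrh, h.p_zero, mul_zero]
  · have h1 := hasDerivWithinAt_comp_compactCoord hrh le_rfl
      (f := reducedP ε M) (by rw [compactCoord_self hrh]; exact h.deriv_p (by simp))
    have h2 := (((hasDerivAt_pow 2 rh).const_mul (-Λ)).hasDerivWithinAt (s := Ici rh)).mul h1
    have h3 := (h2.congr hN (hN rh le_rfl)).derivWithin (hUI rh self_mem_Ici)
    rw [radialDeriv, h3, compactCoord_self hrh]
    have : 0 < -Λ := by linarith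
    exact add_pos_of_nonneg_of_pos (by rw [h.p_zero, mul_zero])
      (mul_pos (by positivity) (mul_pos h.deriv_p_zero_pos (by positivity)))
  · intro r hr
    rw [hN r hr.le]
    have := h.p_pos _ ⟨compactCoord_pos hrh hr, (compactCoord_mem hrh hr.le).2⟩
    have : 0 < -Λ := by linarith
    have : 0 < r := hrh.trans hr
    positivity
  · simp only [compactCoord_self hrh, h.ω_zero]
  · have h1mem : (1 : ℝ) ∈ Icc (0 : ℝ) 1 := by simp
    have hp1 : reducedP ε M 1 = 1 / 3 := by simp [reducedP]
    have hM2 : ∃ M₂, HasDerivWithinAt (fun t => (1 / rh ^ 2) *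
        (reducedP ε M t * v t ^ 2 + ε * (ω t ^ 2 - 1) ^ 2 / 2)) M₂ (Icc 0 1) 1 := by
      have h1 := hvd 1 h1mem
      have h2 := h.deriv_p h1mem
      have h3 := h.deriv_ω 1 h1mem
      exact ⟨_, ((h2.mul (h1.pow 2)).add
        ((((h3.pow 2).sub_const 1).pow 2).const_mul ε |>.div_const 2)).const_mul (1 / rh ^ 2)⟩
    obtain ⟨M₂, hM2⟩ := hM2
    have hS2 : ∃ S₂, HasDerivWithinAt (fun t => Real.exp (σ t) * (2 * (1 / rh ^ 2) * (1 - t) ^ 3 *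
        v t ^ 2)) S₂ (Icc 0 1) 1 := by
      have h1 := hvd 1 h1mem
      have h2 : HasDerivWithinAt (fun t : ℝ => 2 * (1 / rh ^ 2) * (1 - t) ^ 3) _ (Icc 0 1) 1 :=
        ((((hasDerivAt_id (1 : ℝ)).const_sub 1).pow 3).const_mul _).hasDerivWithinAt
      exact ⟨_, (hσd 1 h1mem).exp.mul (h2.mul (h1.pow 2))⟩
    obtain ⟨S₂, hS2⟩ := hS2
    -- At `t = 1` one has `p = 1/3` and `coeff = 0`, so the equation determines `v'(1)`, hence the
    -- `1 / r²` coefficient of `ω`.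
    have hv1 : derivWithin v (Icc 0 1) 1 = -3 * (ε * ((1 - ω 1 ^ 2) * ω 1)) := by
      have := h.mul_deriv_v h1mem (hvd 1 h1mem)
      rw [hp1] at this
      simp [coeff] at this
      linarith
    refine ⟨-Λ * rh ^ 3 * M 1, ω 1, -v 1 * rh, ?_, ?_, ?_⟩
    · refine ((isBigO_expansion_two hrh hM h.deriv_M hM2).2.1.const_mul_left
        (-Λ * rh ^ 3)).congr_left fun r => ?_
      rw [hp1, hε]
      field_simp
      ring
    · refine (isBigO_expansion_two hrh hω h.deriv_ω (hvd 1 h1mem)).2.2.congr_left fun r => ?_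
      rw [hv1, hε]
      field_simp
      ring
    · have := (isBigO_expansion_two (f := fun t => Real.exp (σ t)) hrh hσ.exp
        (fun t ht => (hσd t ht).exp) hS2).1
      simpa [hσ1] using this

end EYM

theorem proposition3 (rh : ℝ) (hrh : 0 < rh) (ωh : ℝ) (hωh : ωh ≠ 0) :
    ∃ L : ℝ, 0 < L ∧ ∀ Λ : ℝ, Λ < 0 → L < |Λ| →
      ∃ m S ω : ℝ → ℝ, EYM.IsRegularBlackHole Λ rh ωh m S ω ∧ ∀ r, rh ≤ r → ω r ≠ 0 := by
  obtain ⟨ε₀, hε₀, H⟩ := EYM.exists_reducedSolution (1 / rh ^ 2) ωh hωh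
  -- This is the condition `ε = 1 / (|Λ| rh²) < ε₀` solved for `|Λ|`.
  refine ⟨1 / (ε₀ * rh ^ 2), by positivity, fun Λ hΛ hL => ?_⟩
  rw [abs_of_neg hΛ, div_lt_iff₀ (by positivity)] at hL
  have hΛ' : 0 < -Λ * rh ^ 2 := by
    have : 0 < -Λ := by linarith
    positivity
  have hε : -1 / (Λ * rh ^ 2) = 1 / (-Λ * rh ^ 2) := by
    rw [neg_mul, div_neg, neg_div]
  obtain ⟨v, ω, M, h⟩ := H (-1 / (Λ * rh ^ 2)) (by rw [hε]; positivity) (by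
    rw [hε, div_lt_iff₀ hΛ']
    linarith)
  obtain ⟨S, hS⟩ := h.exists_isRegularBlackHole hrh hΛ
  exact ⟨_, S, _, hS, fun r hr => h.ω_ne _ (EYM.compactCoord_mem hrh hr)⟩
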